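/- Let $r\ge 1$, let $\mathcal{A}:\mathbb{C}^{m\times n}\to\mathbb{C}^p$ be linear, with adjoint $\mathcal{A}^*$ for the inner products $\langle X,Y\rangle=\mathrm{tr}(Y^HX)$ and $\langle x,y\rangle=y^Hx$, and let $\delta_s(\mathcal{A})$ be the smallest constant with $$(1-\delta_s(\mathcal{A}))\|X\|_F^2\le\|\mathcal{A}X\|_2^2\le(1+\delta_s(\mathcal{A}))\|X\|_F^2\quad\text{for all } X \text{ with } \mathrm{rank}(X)\le s.$$ Let $\mathbb{O}$ be a set of atoms: rank-one matrices of unit Frobenius norm, no two distinct ones collinear, such that every rank-one matrix is a multiple of one of them. For $\Psi\subset\mathbb{O}$ let $P_\Psi$ be the orthogonal projection onto $\mathrm{span}(\Psi)$. Given $b\in\mathbb{C}^p$, the algorithm ADMiRA with target rank $r$ starts from $\widehat X_0=0$, $\widehat\Psi_0=\emptyset$, and in iteration $k+1$ (until a stop criterion holds, if ever) computes, with any choice of optimizers, 1. $\Psi'\in\arg\max_{\Psi\subset\mathbb{O}}\{\|P_\Psi\mathcal{A}^*(b-\mathcal{A}\widehat X_k)\|_F : |\Psi|\le 2r\}$;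 2. $\widetilde X\in\arg\min_Y\{\|b-\mathcal{A}Y\|_2 : Y\in\mathrm{span}(\Psi'\cup\widehat\Psi_k)\}$; 3. $\widehat\Psi_{k+1}\in\arg\max_{\Psi\subset\mathbb{O}}\{\|P_\Psi\widetilde X\|_F : |\Psi|\le r\}$ and $\widehat X_{k+1}=P_{\widehat\Psi_{k+1}}\widetilde X$. **Theorem.** Assume $\delta_{7r}(\mathcal{A})\le 0.043$ and $b=\mathcal{A}X+\nu$ with $X\in\mathbb{C}^{m\times n}$, $\nu\in\mathbb{C}^p$. Let $X_r$ be a best rank-$r$ approximation of $X$ (a minimizer of $\|X-Y\|_F$ over matrices $Y$ of rank at most $r$), and let $$\epsilon=\|X-X_r\|_F+\frac1{\sqrt r}\|X-X_r\|_*+\|\nu\|_2$$ be the unrecoverable energy, where $\|\cdot\|_*$ is the nuclear norm (the sum of the singular values). Then the ADMiRA iterates satisfy, for every $k\ge 0$ for which they are computed, $$\|X-\widehat X_{k+1}\|_F\le 0.5\,\|X-\widehat X_k\|_F+10\,\epsilon \qquad\text{and}\qquad \|X-\widehat X_k\|_F\le 2^{-k}\|X\|_F+20\,\epsilon .$$ 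-/

import Mathlib

open scoped Matrix

/- The space of complex matrices carries the Frobenius norm, written with the usual norm bars. -/
attribute [local instance] Matrix.frobeniusNormedAddCommGroup Matrix.frobeniusNormedSpace

/-- The inner product on `ℂ^{m × n}` that induces the Frobenius norm:
`inner ℂ Y X = tr (Yᴴ X)` (Mathlib's inner product is conjugate-linear in its first argument). -/
noncomputable instance matrixFrobeniusInner (m n : ℕ) :
    InnerProductSpace ℂ (Matrix (Fin m) (Fin n) ℂ) where
  inner Y X := (Yᴴ * X).trace
  norm_sq_eq_re_inner X := by
    rw [Matrix.frobenius_norm_def, ← Real.sqrt_eq_rpow, Real.sq_sqrt (by positivity),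
      Finset.sum_comm]
    simp [Matrix.trace, Matrix.mul_apply, Complex.sq_norm, Complex.normSq_apply]
  conj_inner_symm X Y := by
    rw [starRingEnd_apply, ← Matrix.trace_conjTranspose, Matrix.conjTranspose_mul,
      Matrix.conjTranspose_conjTranspose]
  add_left X Y Z := by
    rw [Matrix.conjTranspose_add, Matrix.add_mul, Matrix.trace_add]
  smul_left X Y c := by
    rw [Matrix.conjTranspose_smul, Matrix.smul_mul, Matrix.trace_smul, smul_eq_mul,
      starRingEnd_apply]

namespace ADMiRA

variable {m n p : ℕ}

/-- `𝕆` is a set of atoms of `ℂ^{m × n}`: rank-one matrices of unit Frobenius norm,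
no two distinct ones collinear, such that every rank-one matrix is a multiple of one of them. -/
structure IsAtomSet (𝕆 : Set (Matrix (Fin m) (Fin n) ℂ)) : Prop where
  rank_eq_one : ∀ ψ ∈ 𝕆, ψ.rank = 1
  norm_eq_one : ∀ ψ ∈ 𝕆, ‖ψ‖ = 1
  not_collinear : ∀ ψ ∈ 𝕆, ∀ φ ∈ 𝕆, (∃ c : ℂ, ψ = c • φ) → ψ = φ
  complete : ∀ X : Matrix (Fin m) (Fin n) ℂ, X.rank = 1 → ∃ ψ ∈ 𝕆, ∃ c : ℂ, X = c • ψ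

/-- `P_Ψ X`: the orthogonal projection of the matrix `X` onto the span of `Ψ`. -/
noncomputable def proj (Ψ : Set (Matrix (Fin m) (Fin n) ℂ)) (X : Matrix (Fin m) (Fin n) ℂ) :
    Matrix (Fin m) (Fin n) ℂ :=
  (Submodule.span ℂ Ψ).starProjection X

/-- `Ψ ∈ argmax {‖P_Φ M‖_F : Φ ⊆ 𝕆, |Φ| ≤ s}`. -/
def IsBestAtoms (𝕆 : Set (Matrix (Fin m) (Fin n) ℂ)) (s : ℕ) (M : Matrix (Fin m) (Fin n) ℂ)
    (Ψ : Set (Matrix (Fin m) (Fin n) ℂ)) : Prop :=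
  (Ψ ⊆ 𝕆 ∧ Ψ.encard ≤ s) ∧
    ∀ Φ : Set (Matrix (Fin m) (Fin n) ℂ), Φ ⊆ 𝕆 → Φ.encard ≤ s → ‖proj Φ M‖ ≤ ‖proj Ψ M‖

/-- `Z ∈ argmin {‖b - 𝒜 Y‖₂ : Y ∈ span Ψ}`. -/
def IsLeastSquares (𝒜 : Matrix (Fin m) (Fin n) ℂ →ₗ[ℂ] EuclideanSpace ℂ (Fin p))
    (b : EuclideanSpace ℂ (Fin p)) (Ψ : Set (Matrix (Fin m) (Fin n) ℂ))
    (Z : Matrix (Fin m) (Fin n) ℂ) : Prop :=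
  Z ∈ Submodule.span ℂ Ψ ∧ ∀ Y ∈ Submodule.span ℂ Ψ, ‖b - 𝒜 Z‖ ≤ ‖b - 𝒜 Y‖

/-- One pass through the loop of ADMiRA, from the estimate and set of atoms `(Xh, Ψh)` to
`(Xh', Ψh')`: `Ψ'` is a best set of at most `2r` atoms for `𝒜* (b - 𝒜 Xh)`, `Xt` solves the
least squares problem on the span of `Ψ' ∪ Ψh`, `Ψh'` is a best set of at most `r` atoms for `Xt`,
and `Xh'` is the projection of `Xt` onto its span. Any choice of optimizers is allowed. -/
def Step (𝕆 : Set (Matrix (Fin m) (Fin n) ℂ))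
    (𝒜 : Matrix (Fin m) (Fin n) ℂ →ₗ[ℂ] EuclideanSpace ℂ (Fin p))
    (b : EuclideanSpace ℂ (Fin p)) (r : ℕ)
    (Xh : Matrix (Fin m) (Fin n) ℂ) (Ψh : Set (Matrix (Fin m) (Fin n) ℂ))
    (Xh' : Matrix (Fin m) (Fin n) ℂ) (Ψh' : Set (Matrix (Fin m) (Fin n) ℂ)) : Prop :=
  ∃ (Ψ' : Set (Matrix (Fin m) (Fin n) ℂ)) (Xt : Matrix (Fin m) (Fin n) ℂ),
    IsBestAtoms 𝕆 (2 * r) (LinearMap.adjoint 𝒜 (b - 𝒜 Xh)) Ψ' ∧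
    IsLeastSquares 𝒜 b (Ψ' ∪ Ψh) Xt ∧
    IsBestAtoms 𝕆 r Xt Ψh' ∧
    Xh' = proj Ψh' Xt

/-- A run of ADMiRA in which the loop is executed `N` times (`N = ⊤` if the stop criterion never
becomes true); `Xh k` is the estimate and `Ψh k` the set of atoms after `k` iterations. -/
structure IsRun (𝕆 : Set (Matrix (Fin m) (Fin n) ℂ))
    (𝒜 : Matrix (Fin m) (Fin n) ℂ →ₗ[ℂ] EuclideanSpace ℂ (Fin p))
    (b : EuclideanSpace ℂ (Fin p)) (r : ℕ) (N : ℕ∞)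
    (Xh : ℕ → Matrix (Fin m) (Fin n) ℂ) (Ψh : ℕ → Set (Matrix (Fin m) (Fin n) ℂ)) : Prop where
  init_estimate : Xh 0 = 0
  init_atoms : Ψh 0 = ∅
  step : ∀ k : ℕ, (k : ℕ∞) < N → Step 𝕆 𝒜 b r (Xh k) (Ψh k) (Xh (k + 1)) (Ψh (k + 1))

/-- The rank-restricted isometry constant `δ_s(𝒜)`: the smallest `δ` with
`(1 - δ) ‖X‖_F² ≤ ‖𝒜 X‖₂² ≤ (1 + δ) ‖X‖_F²` for all `X` of rank at most `s`. -/
noncomputable def ripConst (𝒜 : Matrix (Fin m) (Fin n) ℂ →ₗ[ℂ] EuclideanSpace ℂ (Fin p))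
    (s : ℕ) : ℝ :=
  sInf {δ : ℝ | ∀ X : Matrix (Fin m) (Fin n) ℂ, X.rank ≤ s →
    (1 - δ) * ‖X‖ ^ 2 ≤ ‖𝒜 X‖ ^ 2 ∧ ‖𝒜 X‖ ^ 2 ≤ (1 + δ) * ‖X‖ ^ 2}

/-- The nuclear norm `‖X‖_*`: the sum of all singular values of `X`. -/
noncomputable def nuclearNorm (X : Matrix (Fin m) (Fin n) ℂ) : ℝ :=
  ∑ i ∈ Finset.range n, (Matrix.toEuclideanLin X).singularValues i

/-- `Y` is a best rank-`r` approximation of `X` (in the Frobenius norm). -/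
def IsBestRankApprox (r : ℕ) (X Y : Matrix (Fin m) (Fin n) ℂ) : Prop :=
  Y.rank ≤ r ∧ ∀ Z : Matrix (Fin m) (Fin n) ℂ, Z.rank ≤ r → ‖X - Y‖ ≤ ‖X - Z‖

/-- The unrecoverable energy `‖X - X_r‖_F + ‖X - X_r‖_* / √r + ‖ν‖₂`. -/
noncomputable def unrecoverableEnergy (r : ℕ) (X Xr : Matrix (Fin m) (Fin n) ℂ)
    (ν : EuclideanSpace ℂ (Fin p)) : ℝ :=
  ‖X - Xr‖ + 1 / Real.sqrt r * nuclearNorm (X - Xr) + ‖ν‖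

end ADMiRA

/-! The iteration is analysed with `Xr` as its target: b = 𝒜 Xr + w, where w = 𝒜 (X - Xr) + ν
collects tail and noise. Cutting the singular value decomposition of X - Xr into blocks of rank at
most r bounds ‖w‖ by 1.0213 ε (`norm_map_le_of_rip`).

For a target of rank at most r, the current error S has rank at most 2r. On matrices of low rank 𝒜*
𝒜 is close to the identity, so a best rank-2r approximation of 𝒜* (𝒜 S + w) is close to S
(`norm_sub_le_of_norm_adjoint_sub_le`). Hence the target is close to the span of the merged atoms,
least squares over that span loses little (`norm_sub_leastSquares_le`), and pruning to r atoms at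
most doubles the error. This yields the contraction factor 0.18 in `Step.norm_sub_le`; the room up
to 0.5 and 10 absorbs the passage between `Xr` and X. -/

namespace ADMiRA

/-! ### Restricted isometries and block sums in inner product spaces -/

section Abstract

variable {E F : Type*} [NormedAddCommGroup E] [InnerProductSpace ℂ E]
  [NormedAddCommGroup F] [InnerProductSpace ℂ F]

/-- `A` is an isometry on `U` up to the relative error `δ` in the squared norm. -/
def RestrictedIsometry (A : E →ₗ[ℂ] F) (U : Submodule ℂ E) (δ : ℝ) : Prop :=
  ∀ x ∈ U, (1 - δ) * ‖x‖ ^ 2 ≤ ‖A x‖ ^ 2 ∧ ‖A x‖ ^ 2 ≤ (1 + δ) * ‖x‖ ^ 2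

theorem RestrictedIsometry.norm_le {A : E →ₗ[ℂ] F} {U : Submodule ℂ E} {δ : ℝ}
    (h : RestrictedIsometry A U δ) {c : ℝ} (hc : 0 ≤ c) (hδ : 1 + δ ≤ c ^ 2) {x : E}
    (hx : x ∈ U) : ‖A x‖ ≤ c * ‖x‖ := by
  refine le_of_sq_le_sq ?_ (by positivity)
  rw [mul_pow]
  exact (h x hx).2.trans (by gcongr)

/-- Polarisation with u ± v. Scaling x and y to a common norm first turns (‖x‖² + ‖y‖²) / 2 into the
product ‖x‖ ‖y‖. -/
theorem RestrictedIsometry.abs_re_inner_sub_le {A : E →ₗ[ℂ] F} {U : Submodule ℂ E} {δ : ℝ}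
    (h : RestrictedIsometry A U δ) {x y : E} (hx : x ∈ U) (hy : y ∈ U) :
    |(inner ℂ (A x) (A y)).re - (inner ℂ x y).re| ≤ δ * (‖x‖ * ‖y‖) := by
  rcases eq_or_ne x 0 with rfl | hx0
  · simp
  rcases eq_or_ne y 0 with rfl | hy0
  · simp
  have hpos : 0 < ‖x‖ * ‖y‖ := by positivity
  set u : E := (‖y‖ : ℂ) • x with hu
  set v : E := (‖x‖ : ℂ) • y with hv
  have hnu : ‖u‖ = ‖x‖ * ‖y‖ := by rw [hu, norm_smul]; simp [mul_comm]
  have hnv : ‖v‖ = ‖x‖ * ‖y‖ := by rw [hv, norm_smul]; simp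
  have huU : u ∈ U := U.smul_mem _ hx
  have hvU : v ∈ U := U.smul_mem _ hy
  have e1 : (inner ℂ u v).re = ‖x‖ * ‖y‖ * (inner ℂ x y).re := by
    rw [hu, hv, inner_smul_left, inner_smul_right, Complex.conj_ofReal, Complex.re_ofReal_mul,
      Complex.re_ofReal_mul]
    ring
  have e2 : (inner ℂ (A u) (A v)).re = ‖x‖ * ‖y‖ * (inner ℂ (A x) (A y)).re := by
    rw [hu, hv, map_smul, map_smul, inner_smul_left, inner_smul_right, Complex.conj_ofReal,
      Complex.re_ofReal_mul, Complex.re_ofReal_mul]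
    ring
  have p1 := h (u + v) (U.add_mem huU hvU)
  have p2 := h (u - v) (U.sub_mem huU hvU)
  rw [map_add] at p1
  rw [map_sub] at p2
  have a1 := norm_add_sq (𝕜 := ℂ) u v
  have a2 := norm_sub_sq (𝕜 := ℂ) u v
  have a3 := norm_add_sq (𝕜 := ℂ) (A u) (A v)
  have a4 := norm_sub_sq (𝕜 := ℂ) (A u) (A v)
  simp only [RCLike.re_to_complex] at a1 a2 a3 a4
  rw [e1, hnu, hnv] at a1 a2
  rw [e2] at a3 a4
  rw [a1, a3] at p1
  rw [a2, a4] at p2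
  rw [abs_le]
  constructor
  · refine le_of_mul_le_mul_left ?_ hpos
    nlinarith [p1.1, p2.2]
  · refine le_of_mul_le_mul_left ?_ hpos
    nlinarith [p1.2, p2.1]

/-- A point `Z` that is at least as close as `S` to the back-projection of `A S + w` is close
to `S`. -/
theorem norm_sub_le_of_norm_adjoint_sub_le [FiniteDimensional ℂ E] [FiniteDimensional ℂ F]
    {A : E →ₗ[ℂ] F} {U : Submodule ℂ E} {δ c : ℝ} (h : RestrictedIsometry A U δ)
    (hc : 0 ≤ c) (hδ : 1 + δ ≤ c ^ 2) {S Z : E} {w : F} (hS : S ∈ U) (hZ : Z ∈ U)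
    (hle : ‖LinearMap.adjoint A (A S + w) - Z‖ ≤ ‖LinearMap.adjoint A (A S + w) - S‖) :
    ‖S - Z‖ ≤ 2 * (δ * ‖S‖ + c * ‖w‖) := by
  rcases eq_or_ne (S - Z) 0 with h0 | h0
  -- Only nonnegativity of the right side is needed; the sign of δ is not assumed, but a nonzero S
  -- forces δ ≥ 0.
  · have := h.abs_re_inner_sub_le hS hS
    rw [h0, norm_zero]
    rcases eq_or_ne S 0 with rfl | hS0
    · simp; positivity
    · have hp : 0 < ‖S‖ := norm_pos_iff.2 hS0
      have : 0 ≤ δ * ‖S‖ := by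
        have := (abs_nonneg _).trans this
        rw [← mul_assoc] at this
        exact nonneg_of_mul_nonneg_left this hp
      positivity
  have hpos : 0 < ‖S - Z‖ := norm_pos_iff.2 h0
  set M := LinearMap.adjoint A (A S + w) with hM
  have hd : S - Z ∈ U := U.sub_mem hS hZ
  -- With `hle` this gives ‖S - Z‖² ≤ -2 Re⟪M - S, S - Z⟫, where M - S is small when tested against
  -- U.
  have e := norm_add_sq (𝕜 := ℂ) (M - S) (S - Z)
  rw [sub_add_sub_cancel] at e
  simp only [RCLike.re_to_complex] at e
  have hsq : ‖M - Z‖ ^ 2 ≤ ‖M - S‖ ^ 2 := by gcongr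
  have e3 : (inner ℂ (M - S) (S - Z)).re = (inner ℂ (A S) (A (S - Z))).re
      - (inner ℂ S (S - Z)).re + (inner ℂ w (A (S - Z))).re := by
    rw [inner_sub_left, hM, LinearMap.adjoint_inner_left, inner_add_left, Complex.sub_re,
      Complex.add_re]
    ring
  have b1 := (abs_le.1 (h.abs_re_inner_sub_le hS hd)).1
  have b2 : -(‖w‖ * (c * ‖S - Z‖)) ≤ (inner ℂ w (A (S - Z))).re := by
    have := (abs_le.1 ((Complex.abs_re_le_norm _).trans (norm_inner_le_norm w (A (S - Z))))).1
    have h2 := mul_le_mul_of_nonneg_left (h.norm_le hc hδ hd) (norm_nonneg w)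
    linarith
  refine le_of_mul_le_mul_left ?_ hpos
  nlinarith

/-- If `A Z` is the point of `A T` closest to `A X + w`, then `Z` is almost as close to `X` as
the orthogonal projection of `X` onto `T`. -/
theorem norm_sub_leastSquares_le {A : E →ₗ[ℂ] F} {U T : Submodule ℂ E}
    [T.HasOrthogonalProjection] {δ c : ℝ}
    (h : RestrictedIsometry A U δ) (hδ0 : 0 ≤ δ) (hδ1 : δ < 1)
    (hc : 0 ≤ c) (hδ : 1 + δ ≤ c ^ 2) {X Z : E} {w : F} (hTU : T ≤ U) (hX : X ∈ U) (hZ : Z ∈ T)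
    (hmin : ∀ Y ∈ T, ‖A X + w - A Z‖ ≤ ‖A X + w - A Y‖) :
    (1 - δ) * ‖X - Z‖ ≤ ‖X - T.starProjection X‖ + c * ‖w‖ := by
  set g := X - T.starProjection X with hg
  set k := T.starProjection X - Z with hk
  have hkT : k ∈ T := T.sub_mem (T.starProjection_apply_mem X) hZ
  have hkU := hTU hkT
  have hgU : g ∈ U := U.sub_mem hX (hTU (T.starProjection_apply_mem X))
  have hgk : X - Z = g + k := by rw [hg, hk]; abel
  have horth : inner ℂ g k = 0 := T.starProjection_inner_eq_zero X k hkT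
  have hres : A X + w - A Z = (A g + w) + A k := by
    rw [add_sub_right_comm, ← map_sub, hgk, map_add]; abel
  -- The normal equations: the least squares residual is orthogonal to the image of T.
  have hzero : inner ℂ (A X + w - A Z) (A k) = 0 := by
    have hm : A Z ∈ T.map A := Submodule.mem_map_of_mem hZ
    refine ((T.map A).norm_eq_iInf_iff_inner_eq_zero hm).1 ?_ _ (Submodule.mem_map_of_mem hkT)
    refine le_antisymm (le_ciInf ?_) (ciInf_le ⟨0, ?_⟩ (⟨A Z, hm⟩ : T.map A))
    · rintro ⟨_, Y, hY, rfl⟩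
      exact hmin Y hY
    · rintro _ ⟨_, rfl⟩
      exact norm_nonneg _
  have hk0 : (1 - δ) * ‖k‖ ≤ δ * ‖g‖ + c * ‖w‖ := by
    rcases eq_or_ne k 0 with h0 | h0
    · rw [h0]; simp; positivity
    have hpos : 0 < ‖k‖ := norm_pos_iff.2 h0
    rw [hres, inner_add_left, inner_add_left] at hzero
    have hre := congrArg Complex.re hzero
    simp only [Complex.add_re, Complex.zero_re] at hre
    have hkk : (inner ℂ (A k) (A k)).re = ‖A k‖ ^ 2 := by
      rw [inner_self_eq_norm_sq_to_K]
      norm_cast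
    have b1 := (abs_le.1 (h.abs_re_inner_sub_le hgU hkU)).1
    rw [horth, Complex.zero_re] at b1
    have b2 : -(‖w‖ * (c * ‖k‖)) ≤ (inner ℂ w (A k)).re := by
      have := (abs_le.1 ((Complex.abs_re_le_norm _).trans (norm_inner_le_norm w (A k)))).1
      have h2 := mul_le_mul_of_nonneg_left (h.norm_le hc hδ hkU) (norm_nonneg w)
      linarith
    have b3 := (h k hkU).1
    refine le_of_mul_le_mul_left ?_ hpos
    nlinarith
  -- The terms (1 - δ) ‖g‖ and δ ‖g‖ add up to exactly ‖g‖.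
  have : ‖X - Z‖ ≤ ‖g‖ + ‖k‖ := hgk ▸ norm_add_le g k
  nlinarith

theorem exists_norm_map_le [FiniteDimensional ℂ E] (A : E →ₗ[ℂ] F) :
    ∃ C, 0 ≤ C ∧ ∀ x, ‖A x‖ ≤ C * ‖x‖ :=
  ⟨_, norm_nonneg _, (LinearMap.toContinuousLinearMap A).le_opNorm⟩

theorem norm_sum_sq_of_pairwise_inner_eq_zero {f : ℕ → E}
    (hf : Pairwise fun i j => inner ℂ (f i) (f j) = 0) (s : Finset ℕ) :
    ‖∑ i ∈ s, f i‖ ^ 2 = ∑ i ∈ s, ‖f i‖ ^ 2 := by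
  induction s using Finset.induction_on with
  | empty => simp
  | insert a s ha ih =>
    have h0 : inner ℂ (f a) (∑ i ∈ s, f i) = 0 := by
      rw [inner_sum]
      exact Finset.sum_eq_zero fun i hi => hf (ne_of_mem_of_not_mem hi ha).symm
    rw [Finset.sum_insert ha, Finset.sum_insert ha, ← ih, sq, sq, sq]
    simpa [sq] using norm_add_sq_eq_norm_sq_add_norm_sq_of_inner_eq_zero _ _ h0

/-- Cutting a sum of orthogonal vectors of decreasing norm into blocks of length `r`. -/
theorem norm_map_sum_le_of_blocks (A : E →ₗ[ℂ] F) {f : ℕ → E} {r : ℕ} (hr : 1 ≤ r) {c : ℝ}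
    (hc : 0 ≤ c) (hf : Pairwise fun i j => inner ℂ (f i) (f j) = 0)
    (hanti : Antitone fun i => ‖f i‖)
    (hA : ∀ a, ‖A (∑ i ∈ Finset.Ico a (a + r), f i)‖ ≤ c * ‖∑ i ∈ Finset.Ico a (a + r), f i‖)
    (k : ℕ) :
    ‖A (∑ i ∈ Finset.range (r * (k + 1)), f i)‖ ≤
      c * (‖∑ i ∈ Finset.range r, f i‖
        + 1 / Real.sqrt r * ∑ i ∈ Finset.range (r * k), ‖f i‖) := by
  induction k with
  | zero => simpa using hA 0
  | succ k ih =>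
    have hr0 : (0 : ℝ) < r := by exact_mod_cast hr
    have hs : 0 < Real.sqrt r := Real.sqrt_pos.2 hr0
    set t := ‖f (r * (k + 1))‖ with ht
    -- The largest norm t in the new block is at most the average over the preceding block, which is
    -- why the sum of norms lags one block behind.
    have h1 : ‖∑ i ∈ Finset.Ico (r * (k + 1)) (r * (k + 1) + r), f i‖ ≤ Real.sqrt r * t := by
      refine le_of_sq_le_sq ?_ (by positivity)
      rw [norm_sum_sq_of_pairwise_inner_eq_zero hf, mul_pow, Real.sq_sqrt hr0.le]
      calc _ ≤ ∑ i ∈ Finset.Ico (r * (k + 1)) (r * (k + 1) + r), t ^ 2 := by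
            refine Finset.sum_le_sum fun i hi => ?_
            have : ‖f i‖ ≤ t := hanti (Finset.mem_Ico.1 hi).1
            gcongr
        _ = r * t ^ 2 := by simp
    have h2 : r * t ≤ ∑ i ∈ Finset.Ico (r * k) (r * (k + 1)), ‖f i‖ := by
      calc (r : ℝ) * t = ∑ i ∈ Finset.Ico (r * k) (r * (k + 1)), t := by
            simp [mul_add]
        _ ≤ _ := Finset.sum_le_sum fun i hi => hanti (Finset.mem_Ico.1 hi).2.le
    have h3 : Real.sqrt r * t ≤ 1 / Real.sqrt r *
        ∑ i ∈ Finset.Ico (r * k) (r * (k + 1)), ‖f i‖ := by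
      rw [one_div, ← div_eq_inv_mul, le_div_iff₀ hs]
      calc _ = Real.sqrt r * Real.sqrt r * t := by ring
        _ ≤ _ := by rwa [Real.mul_self_sqrt hr0.le]
    have e1 : r * (k + 1 + 1) = r * (k + 1) + r := by ring
    rw [e1, ← Finset.sum_range_add_sum_Ico _ (Nat.le_add_right (r * (k + 1)) r), map_add,
      ← Finset.sum_range_add_sum_Ico (fun i => ‖f i‖) (Nat.mul_le_mul_left r (Nat.le_succ k))]
    refine (norm_add_le _ _).trans ((add_le_add ih (hA _)).trans ?_)
    have h4 := mul_le_mul_of_nonneg_left (h1.trans h3) hc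
    calc _ ≤ _ := add_le_add_right h4 _
      _ = _ := by ring

end Abstract

variable {m n p : ℕ}

/-! ### Rank and the singular value decomposition -/

theorem rank_add_le (X Y : Matrix (Fin m) (Fin n) ℂ) : (X + Y).rank ≤ X.rank + Y.rank := by
  unfold Matrix.rank
  rw [Matrix.mulVecLin_add]
  exact (Submodule.finrank_mono (LinearMap.range_add_le _ _)).trans
    (Submodule.finrank_add_le_finrank_add_finrank _ _)

theorem rank_smul_le (c : ℂ) (X : Matrix (Fin m) (Fin n) ℂ) : (c • X).rank ≤ X.rank := by
  have : c • X = (c • (1 : Matrix (Fin m) (Fin m) ℂ)) * X := by simp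
  rw [this]
  exact Matrix.rank_mul_le_right _ _

theorem rank_neg (X : Matrix (Fin m) (Fin n) ℂ) : (-X).rank ≤ X.rank := by
  simpa using rank_smul_le (-1) X

theorem rank_sum_le_card {ι : Type*} (s : Finset ι) (f : ι → Matrix (Fin m) (Fin n) ℂ)
    (hf : ∀ i ∈ s, (f i).rank ≤ 1) : (∑ i ∈ s, f i).rank ≤ s.card := by
  classical
  induction s using Finset.induction_on with
  | empty => simp
  | insert a s ha ih =>
    rw [Finset.sum_insert ha, Finset.card_insert_of_notMem ha, add_comm s.card]
    exact (rank_add_le _ _).trans (add_le_add (hf a (by simp))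
      (ih fun i hi => hf i (Finset.mem_insert_of_mem hi)))

theorem rank_le_of_mem_span {Ψ : Set (Matrix (Fin m) (Fin n) ℂ)} (hΨ : ∀ ψ ∈ Ψ, ψ.rank ≤ 1)
    {s : ℕ} (hs : Ψ.encard ≤ s) {X : Matrix (Fin m) (Fin n) ℂ} (hX : X ∈ Submodule.span ℂ Ψ) :
    X.rank ≤ s := by
  have hfin : Ψ.Finite := Set.finite_of_encard_le_coe hs
  obtain ⟨t, rfl⟩ := hfin.exists_finset_coe
  rw [Set.encard_coe_eq_coe_finsetCard] at hs
  obtain ⟨c, -, rfl⟩ := Submodule.mem_span_finset.1 hX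
  exact (rank_sum_le_card t _ fun ψ hψ => (rank_smul_le _ _).trans (hΨ ψ hψ)).trans
    (by exact_mod_cast hs)

theorem inner_vecMulVec (a c : Fin m → ℂ) (b d : Fin n → ℂ) :
    inner ℂ (Matrix.vecMulVec a b) (Matrix.vecMulVec c d) = (star a ⬝ᵥ c) * (star b ⬝ᵥ d) := by
  change ((Matrix.vecMulVec a b)ᴴ * Matrix.vecMulVec c d).trace = _
  rw [Matrix.conjTranspose_vecMulVec, Matrix.vecMulVec_mul_vecMulVec,
    Matrix.trace_vecMulVec, dotProduct_smul, smul_eq_mul]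

/-- The singular value decomposition, as a sum of orthogonal matrices of rank at most one. -/
theorem exists_orthogonal_decomposition (Y : Matrix (Fin m) (Fin n) ℂ) :
    ∃ f : ℕ → Matrix (Fin m) (Fin n) ℂ, (∀ i, (f i).rank ≤ 1) ∧
      (Pairwise fun i j => inner ℂ (f i) (f j) = 0) ∧
      (∀ i, ‖f i‖ = (Matrix.toEuclideanLin Y).singularValues i) ∧
      Y = ∑ i ∈ Finset.range n, f i := by
  set T := Matrix.toEuclideanLin Y with hT
  have hn : Module.finrank ℂ (EuclideanSpace ℂ (Fin n)) = n := by simp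
  have hsymm := T.isSymmetric_adjoint_comp_self
  set v := hsymm.eigenvectorBasis hn with hv
  -- These are T vᵢ vᵢᴴ for an eigenbasis v of T* T; their inner products factor as ⟪T vᵢ, T vⱼ⟫
  -- ⟪vⱼ, vᵢ⟫.
  set g : Fin n → Matrix (Fin m) (Fin n) ℂ :=
    fun i => Matrix.vecMulVec (T (v i)).ofLp (star (v i).ofLp) with hg
  have hvv : ∀ i j, star (star (v i).ofLp) ⬝ᵥ star (v j).ofLp = inner ℂ (v j) (v i) := by
    intro i j
    rw [EuclideanSpace.inner_eq_star_dotProduct, star_star]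
  have hTT : ∀ i j, star (T (v i)).ofLp ⬝ᵥ (T (v j)).ofLp = inner ℂ (T (v i)) (T (v j)) := by
    intro i j
    rw [EuclideanSpace.inner_eq_star_dotProduct, dotProduct_comm]
  have hnorm : ∀ i, ‖g i‖ = T.singularValues i := by
    intro i
    have h1 : (inner ℂ (g i) (g i) : ℂ) = (T.singularValues i : ℂ) ^ 2 := by
      rw [hg, inner_vecMulVec, hvv, hTT, ← LinearMap.adjoint_inner_right,
        ← LinearMap.comp_apply, hsymm.apply_eigenvectorBasis, inner_smul_right,
        inner_self_eq_norm_sq_to_K, ← T.sq_singularValues_fin hn i]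
      simp [v.orthonormal.1 i]
    rw [inner_self_eq_norm_sq_to_K] at h1
    have h2 : ‖g i‖ ^ 2 = T.singularValues i ^ 2 := Complex.ofReal_injective (by simpa using h1)
    exact (sq_eq_sq₀ (norm_nonneg _) (T.singularValues_nonneg _)).1 h2
  have horth : ∀ i j, i ≠ j → inner ℂ (g i) (g j) = 0 := by
    intro i j hij
    rw [hg, inner_vecMulVec, hvv, v.orthonormal.2 hij.symm, mul_zero]
  have hsum : Y = ∑ i, g i := by
    apply Matrix.toEuclideanLin.injective
    refine v.toBasis.ext fun j => ?_
    rw [map_sum, LinearMap.sum_apply, Finset.sum_eq_single j]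
    · have : star (v j).ofLp ⬝ᵥ (v j).ofLp = 1 := by
        rw [dotProduct_comm, ← EuclideanSpace.inner_eq_star_dotProduct,
          inner_self_eq_norm_sq_to_K, v.orthonormal.1 j]
        simp
      ext i
      simp only [OrthonormalBasis.coe_toBasis, Matrix.ofLp_toLpLin, Matrix.toLin'_apply, hg,
        Matrix.vecMulVec_mulVec, this]
      simp [hT]
    · intro i _ hij
      have : star (v i).ofLp ⬝ᵥ (v j).ofLp = 0 := by
        rw [dotProduct_comm, ← EuclideanSpace.inner_eq_star_dotProduct, v.orthonormal.2 hij]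
      ext k
      simp only [OrthonormalBasis.coe_toBasis, Matrix.ofLp_toLpLin, Matrix.toLin'_apply, hg,
        Matrix.vecMulVec_mulVec, this]
      simp
    · simp
  -- Padding with zeros lets later blocks run past n.
  refine ⟨fun i => if h : i < n then g ⟨i, h⟩ else 0, fun i => ?_, fun i j hij => ?_, fun i => ?_,
    ?_⟩
  · dsimp only
    split_ifs
    · exact Matrix.rank_vecMulVec_le _ _
    · simp
  · dsimp only
    split_ifs with h1 h2
    · exact horth _ _ (by simpa using hij)
    all_goals simp
  · dsimp only
    split_ifs with h
    · exact hnorm ⟨i, h⟩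
    · rw [norm_zero, T.singularValues_of_finrank_le (by rw [hn]; exact not_lt.1 h)]
  · rw [Finset.sum_range, hsum]
    exact Finset.sum_congr rfl fun i _ => by simp

theorem exists_eq_sum_of_rank_le {X : Matrix (Fin m) (Fin n) ℂ} {s : ℕ} (hX : X.rank ≤ s) :
    ∃ f : ℕ → Matrix (Fin m) (Fin n) ℂ, (∀ i, (f i).rank ≤ 1) ∧
      X = ∑ i ∈ Finset.range s, f i := by
  obtain ⟨f, hf, -, hnorm, hsum⟩ := exists_orthogonal_decomposition X
  refine ⟨f, hf, ?_⟩
  have hrank : X.rank = Module.finrank ℂ (Matrix.toEuclideanLin X).range :=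
    X.rank_eq_finrank_range_toLin (EuclideanSpace.basisFun (Fin m) ℂ).toBasis
      (EuclideanSpace.basisFun (Fin n) ℂ).toBasis
  have hzero : ∀ i ∉ Finset.range X.rank, f i = 0 := by
    intro i hi
    rw [← norm_eq_zero, hnorm, LinearMap.singularValues_eq_zero_iff_le_finrank_range, ← hrank]
    simpa using hi
  -- Needed for both s and n, which are not comparable; both sums reduce to the first `X.rank`
  -- terms.
  have hsub : ∀ {N : ℕ}, X.rank ≤ N →
      ∑ i ∈ Finset.range X.rank, f i = ∑ i ∈ Finset.range N, f i := fun hN =>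
    Finset.sum_subset (Finset.range_mono hN) fun i _ hi => hzero i hi
  rw [← hsub hX, hsub X.rank_le_width]
  exact hsum

/-! ### Atoms and best low-rank approximation -/

theorem IsAtomSet.exists_mem_span_of_rank_le {𝕆 : Set (Matrix (Fin m) (Fin n) ℂ)}
    (h𝕆 : IsAtomSet 𝕆) {X : Matrix (Fin m) (Fin n) ℂ} {s : ℕ} (hX : X.rank ≤ s) :
    ∃ Φ ⊆ 𝕆, Φ.encard ≤ s ∧ X ∈ Submodule.span ℂ Φ := by
  have hone : ∀ Y : Matrix (Fin m) (Fin n) ℂ, Y.rank ≤ 1 →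
      ∃ Φ ⊆ 𝕆, Φ.encard ≤ 1 ∧ Y ∈ Submodule.span ℂ Φ := by
    intro Y hY
    rcases Nat.le_one_iff_eq_zero_or_eq_one.1 hY with h0 | h1
    · obtain ⟨f, -, rfl⟩ := exists_eq_sum_of_rank_le h0.le
      exact ⟨∅, by simp⟩
    · obtain ⟨ψ, hψ, c, rfl⟩ := h𝕆.complete Y h1
      exact ⟨{ψ}, by simpa, by simp,
        Submodule.smul_mem _ _ (Submodule.mem_span_singleton_self ψ)⟩
  obtain ⟨f, hf, rfl⟩ := exists_eq_sum_of_rank_le hX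
  clear hX
  induction s with
  | zero => exact ⟨∅, by simp⟩
  | succ s ih =>
    obtain ⟨Φ, hΦ, hcard, hmem⟩ := ih
    obtain ⟨Φ', hΦ', hcard', hmem'⟩ := hone (f s) (hf s)
    refine ⟨Φ ∪ Φ', Set.union_subset hΦ hΦ',
      (Set.encard_union_le _ _).trans (by push_cast; exact add_le_add hcard hcard'), ?_⟩
    rw [Finset.sum_range_succ]
    exact add_mem (Submodule.span_mono Set.subset_union_left hmem)
      (Submodule.span_mono Set.subset_union_right hmem')

theorem norm_sub_proj_sq (Ψ : Set (Matrix (Fin m) (Fin n) ℂ)) (M : Matrix (Fin m) (Fin n) ℂ) :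
    ‖M - proj Ψ M‖ ^ 2 = ‖M‖ ^ 2 - ‖proj Ψ M‖ ^ 2 := by
  have h := Submodule.norm_sq_eq_add_norm_sq_starProjection M (Submodule.span ℂ Ψ)
  rw [Submodule.starProjection_orthogonal_val] at h
  unfold proj
  linarith

theorem norm_sub_starProjection_le {E : Type*} [NormedAddCommGroup E] [InnerProductSpace ℂ E]
    (U : Submodule ℂ E) [U.HasOrthogonalProjection] (x : E) {y : E} (hy : y ∈ U) :
    ‖x - U.starProjection x‖ ≤ ‖x - y‖ := by
  rw [U.starProjection_minimal]
  exact ciInf_le ⟨0, by rintro _ ⟨_, rfl⟩; exact norm_nonneg _⟩ (⟨y, hy⟩ : U)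

/-- The projection onto a best set of `s` atoms is a best approximation of rank at most `s`. -/
theorem IsBestAtoms.norm_sub_proj_le {𝕆 : Set (Matrix (Fin m) (Fin n) ℂ)} (h𝕆 : IsAtomSet 𝕆)
    {s : ℕ} {M : Matrix (Fin m) (Fin n) ℂ} {Ψ : Set (Matrix (Fin m) (Fin n) ℂ)}
    (hΨ : IsBestAtoms 𝕆 s M Ψ) {Z : Matrix (Fin m) (Fin n) ℂ} (hZ : Z.rank ≤ s) :
    ‖M - proj Ψ M‖ ≤ ‖M - Z‖ := by
  obtain ⟨Φ, hΦ, hcard, hmem⟩ := h𝕆.exists_mem_span_of_rank_le hZ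
  refine le_trans ?_ (norm_sub_starProjection_le (Submodule.span ℂ Φ) M hmem)
  change ‖M - proj Ψ M‖ ≤ ‖M - proj Φ M‖
  -- By Pythagoras, maximising the projection minimises the residual.
  refine le_of_sq_le_sq ?_ (norm_nonneg _)
  rw [norm_sub_proj_sq, norm_sub_proj_sq]
  have := hΨ.2 Φ hΦ hcard
  gcongr

/-! ### Isometry constant and the image of the tail -/

theorem rip_of_ripConst_le (𝒜 : Matrix (Fin m) (Fin n) ℂ →ₗ[ℂ] EuclideanSpace ℂ (Fin p))
    {s : ℕ} {δ : ℝ} (h : ripConst 𝒜 s ≤ δ) {X : Matrix (Fin m) (Fin n) ℂ} (hX : X.rank ≤ s) :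
    (1 - δ) * ‖X‖ ^ 2 ≤ ‖𝒜 X‖ ^ 2 ∧ ‖𝒜 X‖ ^ 2 ≤ (1 + δ) * ‖X‖ ^ 2 := by
  have hne : {δ : ℝ | ∀ X : Matrix (Fin m) (Fin n) ℂ, X.rank ≤ s →
      (1 - δ) * ‖X‖ ^ 2 ≤ ‖𝒜 X‖ ^ 2 ∧ ‖𝒜 X‖ ^ 2 ≤ (1 + δ) * ‖X‖ ^ 2}.Nonempty := by
    obtain ⟨C, hC, hbound⟩ := exists_norm_map_le 𝒜
    -- This value makes the lower bound trivial, its left side being nonpositive.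
    refine ⟨1 + C ^ 2, fun Y _ => ?_⟩
    have h1 : ‖𝒜 Y‖ ^ 2 ≤ C ^ 2 * ‖Y‖ ^ 2 := by
      rw [← mul_pow]
      have := hbound Y
      gcongr
    constructor <;> nlinarith [sq_nonneg ‖𝒜 Y‖, sq_nonneg ‖Y‖]
  have key : ∀ η > 0, (1 - δ) * ‖X‖ ^ 2 ≤ ‖𝒜 X‖ ^ 2 + η ∧
      ‖𝒜 X‖ ^ 2 ≤ (1 + δ) * ‖X‖ ^ 2 + η := by
    intro η hη
    have hpos : 0 < ‖X‖ ^ 2 + 1 := by positivity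
    obtain ⟨δ', hδ', hlt⟩ := exists_lt_of_csInf_lt hne
      (h.trans_lt (lt_add_of_pos_right δ (div_pos hη hpos)))
    have h1 := hδ' X hX
    have h2 : (δ' - δ) * ‖X‖ ^ 2 ≤ η := by
      have : η / (‖X‖ ^ 2 + 1) * ‖X‖ ^ 2 ≤ η := by
        rw [div_mul_eq_mul_div, div_le_iff₀ hpos]
        nlinarith
      have h3 : (δ' - δ) * ‖X‖ ^ 2 ≤ η / (‖X‖ ^ 2 + 1) * ‖X‖ ^ 2 := by
        gcongr
        linarith
      linarith
    constructor <;> linarith [h1.1, h1.2]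
  exact ⟨le_of_forall_pos_le_add fun η hη => (key η hη).1,
    le_of_forall_pos_le_add fun η hη => (key η hη).2⟩

/-- Extends a bound on rank at most r to all matrices, at the price of the nuclear norm: the
singular value decomposition is cut into n + 1 blocks of r terms, enough since r ≥ 1. -/
theorem norm_map_le_of_rip (𝒜 : Matrix (Fin m) (Fin n) ℂ →ₗ[ℂ] EuclideanSpace ℂ (Fin p))
    {r : ℕ} (hr : 1 ≤ r) {c : ℝ} (hc : 0 ≤ c)
    (h : ∀ X : Matrix (Fin m) (Fin n) ℂ, X.rank ≤ r → ‖𝒜 X‖ ≤ c * ‖X‖)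
    (Y : Matrix (Fin m) (Fin n) ℂ) :
    ‖𝒜 Y‖ ≤ c * (‖Y‖ + 1 / Real.sqrt r * nuclearNorm Y) := by
  obtain ⟨f, hf, horth, hnorm, hsum⟩ := exists_orthogonal_decomposition Y
  have hanti : Antitone fun i => ‖f i‖ := by
    intro i j hij
    simp only [hnorm]
    exact LinearMap.singularValues_antitone _ hij
  have hzero : ∀ i ∉ Finset.range n, ‖f i‖ = 0 := by
    intro i hi
    rw [hnorm, LinearMap.singularValues_of_finrank_le _ (by simpa using hi)]
  have hn1 : n ≤ r * n := Nat.le_mul_of_pos_left n hr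
  have hn2 : n ≤ r * (n + 1) := hn1.trans (Nat.mul_le_mul_left r n.le_succ)
  have hY : ∑ i ∈ Finset.range (r * (n + 1)), f i = Y := by
    conv_rhs => rw [hsum]
    exact (Finset.sum_subset (Finset.range_mono hn2)
      fun i _ hi => norm_eq_zero.1 (hzero i hi)).symm
  have hnuc : ∑ i ∈ Finset.range (r * n), ‖f i‖ = nuclearNorm Y := by
    rw [nuclearNorm, ← Finset.sum_subset (Finset.range_mono hn1) fun i _ hi => hzero i hi]
    exact Finset.sum_congr rfl fun i _ => hnorm i
  have hhead : ‖∑ i ∈ Finset.range r, f i‖ ≤ ‖Y‖ := by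
    refine le_of_sq_le_sq ?_ (norm_nonneg _)
    rw [← hY, norm_sum_sq_of_pairwise_inner_eq_zero horth,
      norm_sum_sq_of_pairwise_inner_eq_zero horth]
    exact Finset.sum_le_sum_of_subset_of_nonneg
      (Finset.range_mono (Nat.le_mul_of_pos_right r n.succ_pos)) fun i _ _ => by positivity
  have := norm_map_sum_le_of_blocks 𝒜 hr hc horth hanti (fun a => h _ ?_) n
  · rw [hY, hnuc] at this
    exact this.trans (by gcongr)
  · simpa using rank_sum_le_card (Finset.Ico a (a + r)) f fun i _ => hf i

theorem nuclearNorm_nonneg (X : Matrix (Fin m) (Fin n) ℂ) : 0 ≤ nuclearNorm X :=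
  Finset.sum_nonneg fun i _ => LinearMap.singularValues_nonneg _ i

/-! ### One iteration -/

/-- An estimate of ADMiRA is a combination of `r` atoms. -/
structure IsEstimate (𝕆 : Set (Matrix (Fin m) (Fin n) ℂ)) (r : ℕ)
    (Xh : Matrix (Fin m) (Fin n) ℂ) (Ψh : Set (Matrix (Fin m) (Fin n) ℂ)) : Prop where
  subset : Ψh ⊆ 𝕆
  encard_le : Ψh.encard ≤ r
  mem_span : Xh ∈ Submodule.span ℂ Ψh

theorem Step.isEstimate {𝕆 : Set (Matrix (Fin m) (Fin n) ℂ)}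
    {𝒜 : Matrix (Fin m) (Fin n) ℂ →ₗ[ℂ] EuclideanSpace ℂ (Fin p)}
    {b : EuclideanSpace ℂ (Fin p)} {r : ℕ} {Xh Xh' : Matrix (Fin m) (Fin n) ℂ}
    {Ψh Ψh' : Set (Matrix (Fin m) (Fin n) ℂ)} (h : Step 𝕆 𝒜 b r Xh Ψh Xh' Ψh') :
    IsEstimate 𝕆 r Xh' Ψh' := by
  obtain ⟨Ψ', Xt, -, -, hbest, rfl⟩ := h
  exact ⟨hbest.1.1, hbest.1.2, Submodule.starProjection_apply_mem _ _⟩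

theorem rank_le_of_mem_span_sup_span_singleton {Ψ : Set (Matrix (Fin m) (Fin n) ℂ)}
    (hΨ : ∀ ψ ∈ Ψ, ψ.rank ≤ 1) {s t : ℕ} (hs : Ψ.encard ≤ s) {S X : Matrix (Fin m) (Fin n) ℂ}
    (hS : S.rank ≤ t) (hX : X ∈ Submodule.span ℂ Ψ ⊔ Submodule.span ℂ {S}) :
    X.rank ≤ s + t := by
  obtain ⟨Y, hY, Z, hZ, rfl⟩ := Submodule.mem_sup.1 hX
  obtain ⟨c, rfl⟩ := Submodule.mem_span_singleton.1 hZ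
  exact (rank_add_le _ _).trans
    (add_le_add (rank_le_of_mem_span hΨ hs hY) ((rank_smul_le c S).trans hS))

/-- The error in recovering a matrix of rank at most `r` shrinks in each iteration. -/
theorem Step.norm_sub_le {𝕆 : Set (Matrix (Fin m) (Fin n) ℂ)} (h𝕆 : IsAtomSet 𝕆)
    {𝒜 : Matrix (Fin m) (Fin n) ℂ →ₗ[ℂ] EuclideanSpace ℂ (Fin p)} {r : ℕ}
    (h𝒜 : ∀ X : Matrix (Fin m) (Fin n) ℂ, X.rank ≤ 4 * r →
      (1 - 0.043) * ‖X‖ ^ 2 ≤ ‖𝒜 X‖ ^ 2 ∧ ‖𝒜 X‖ ^ 2 ≤ (1 + 0.043) * ‖X‖ ^ 2)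
    {X Xh Xh' : Matrix (Fin m) (Fin n) ℂ} {Ψh Ψh' : Set (Matrix (Fin m) (Fin n) ℂ)}
    {w : EuclideanSpace ℂ (Fin p)} (hX : X.rank ≤ r) (hest : IsEstimate 𝕆 r Xh Ψh)
    (h : Step 𝕆 𝒜 (𝒜 X + w) r Xh Ψh Xh' Ψh') :
    ‖X - Xh'‖ ≤ 0.18 * ‖X - Xh‖ + 6.41 * ‖w‖ := by
  obtain ⟨Ψ', Xt, hΨ', hls, hbest, rfl⟩ := h
  have hatom : ∀ ψ ∈ 𝕆, ψ.rank ≤ 1 := fun ψ hψ => (h𝕆.rank_eq_one ψ hψ).le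
  have hXh : Xh.rank ≤ r :=
    rank_le_of_mem_span (fun ψ hψ => hatom ψ (hest.subset hψ)) hest.encard_le hest.mem_span
  set S := X - Xh with hS
  have hSrank : S.rank ≤ 2 * r := by
    rw [hS, sub_eq_add_neg]
    have := (rank_add_le X (-Xh)).trans (add_le_add hX ((rank_neg Xh).trans hXh))
    omega
  have hres : 𝒜 X + w - 𝒜 Xh = 𝒜 S + w := by rw [hS, map_sub]; abel
  rw [hres] at hΨ'
  set M := LinearMap.adjoint 𝒜 (𝒜 S + w) with hM
  have hPM : proj Ψ' M ∈ Submodule.span ℂ Ψ' := Submodule.starProjection_apply_mem _ _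
  have hcard' : Ψ'.encard ≤ ((2 * r : ℕ) : ℕ∞) := by exact_mod_cast hΨ'.1.2
  have h1 : ‖S - proj Ψ' M‖ ≤ 2 * (0.043 * ‖S‖ + 1.0213 * ‖w‖) := by
    -- Ranks here are at most 2r + 2r.
    have hU : RestrictedIsometry 𝒜 (Submodule.span ℂ Ψ' ⊔ Submodule.span ℂ {S}) 0.043 :=
      fun Y hY => h𝒜 Y ((rank_le_of_mem_span_sup_span_singleton
        (fun ψ hψ => hatom ψ (hΨ'.1.1 hψ)) hcard' hSrank hY).trans (by omega))
    exact norm_sub_le_of_norm_adjoint_sub_le hU (by norm_num) (by norm_num)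
      (Submodule.mem_sup_right (Submodule.mem_span_singleton_self S))
      (Submodule.mem_sup_left hPM) (hΨ'.norm_sub_proj_le h𝕆 hSrank)
  set T := Submodule.span ℂ (Ψ' ∪ Ψh) with hT
  have h2 : ‖X - T.starProjection X‖ ≤ ‖S - proj Ψ' M‖ := by
    -- Since X = Xh + S, an approximation of S in the span of `Ψ'` shifts to one of X in T.
    have hmem : Xh + proj Ψ' M ∈ T :=
      add_mem (Submodule.span_mono Set.subset_union_right hest.mem_span)
        (Submodule.span_mono Set.subset_union_left hPM)
    rw [hS, sub_sub]
    exact norm_sub_starProjection_le T X hmem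
  have h3 : (1 - 0.043) * ‖X - Xt‖ ≤ ‖X - T.starProjection X‖ + 1.0213 * ‖w‖ := by
    have hcard : (Ψ' ∪ Ψh).encard ≤ ((2 * r + r : ℕ) : ℕ∞) := by
      rw [Nat.cast_add]
      exact (Set.encard_union_le _ _).trans (add_le_add hcard' hest.encard_le)
    -- Ranks here are at most 3r + r.
    have hU : RestrictedIsometry 𝒜 (T ⊔ Submodule.span ℂ {X}) 0.043 :=
      fun Y hY => h𝒜 Y ((rank_le_of_mem_span_sup_span_singleton
        (fun ψ hψ => hatom ψ (Set.union_subset hΨ'.1.1 hest.subset hψ)) hcard hX hY).trans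
          (by omega))
    exact norm_sub_leastSquares_le hU (by norm_num) (by norm_num) (by norm_num) (by norm_num)
      le_sup_left (Submodule.mem_sup_right (Submodule.mem_span_singleton_self X)) hls.1 hls.2
  have h4 : ‖X - proj Ψh' Xt‖ ≤ 2 * ‖X - Xt‖ := by
    have := hbest.norm_sub_proj_le h𝕆 hX
    rw [norm_sub_rev Xt X] at this
    linarith [norm_sub_le_norm_sub_add_norm_sub X Xt (proj Ψh' Xt)]
  -- The constants are 2 · 0.086 / 0.957 < 0.18 and 2 · (3 · 1.0213) / 0.957 < 6.41.
  linarith [norm_nonneg w, norm_nonneg S]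

theorem IsRun.isEstimate {𝕆 : Set (Matrix (Fin m) (Fin n) ℂ)}
    {𝒜 : Matrix (Fin m) (Fin n) ℂ →ₗ[ℂ] EuclideanSpace ℂ (Fin p)}
    {b : EuclideanSpace ℂ (Fin p)} {r : ℕ} {N : ℕ∞} {Xh : ℕ → Matrix (Fin m) (Fin n) ℂ}
    {Ψh : ℕ → Set (Matrix (Fin m) (Fin n) ℂ)} (h : IsRun 𝕆 𝒜 b r N Xh Ψh) :
    ∀ k : ℕ, (k : ℕ∞) ≤ N → IsEstimate 𝕆 r (Xh k) (Ψh k)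
  | 0, _ => by rw [h.init_estimate, h.init_atoms]; exact ⟨by simp, by simp, zero_mem _⟩
  | k + 1, hk => (h.step k (lt_of_lt_of_le (by exact_mod_cast k.lt_succ_self) hk)).isEstimate

end ADMiRA

/-! ### Transfer to arbitrary X -/

theorem theorem1 (m n p r : ℕ) (hr : 1 ≤ r)
    (𝕆 : Set (Matrix (Fin m) (Fin n) ℂ)) (h𝕆 : ADMiRA.IsAtomSet 𝕆)
    (𝒜 : Matrix (Fin m) (Fin n) ℂ →ₗ[ℂ] EuclideanSpace ℂ (Fin p))
    (h𝒜 : ADMiRA.ripConst 𝒜 (7 * r) ≤ 0.043)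
    (X Xr : Matrix (Fin m) (Fin n) ℂ) (hXr : ADMiRA.IsBestRankApprox r X Xr)
    (b ν : EuclideanSpace ℂ (Fin p)) (hb : b = 𝒜 X + ν)
    (N : ℕ∞) (Xh : ℕ → Matrix (Fin m) (Fin n) ℂ) (Ψh : ℕ → Set (Matrix (Fin m) (Fin n) ℂ))
    (hrun : ADMiRA.IsRun 𝕆 𝒜 b r N Xh Ψh) :
    (∀ k : ℕ, (k : ℕ∞) < N →
      ‖X - Xh (k + 1)‖ ≤ 0.5 * ‖X - Xh k‖ + 10 * ADMiRA.unrecoverableEnergy r X Xr ν) ∧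
    (∀ k : ℕ, (k : ℕ∞) ≤ N →
      ‖X - Xh k‖ ≤ (1 / 2 : ℝ) ^ k * ‖X‖ + 20 * ADMiRA.unrecoverableEnergy r X Xr ν) := by
  have hrip : ∀ s ≤ 7 * r, ∀ Y : Matrix (Fin m) (Fin n) ℂ, Y.rank ≤ s →
      (1 - 0.043) * ‖Y‖ ^ 2 ≤ ‖𝒜 Y‖ ^ 2 ∧ ‖𝒜 Y‖ ^ 2 ≤ (1 + 0.043) * ‖Y‖ ^ 2 :=
    fun s hs Y hY => ADMiRA.rip_of_ripConst_le 𝒜 h𝒜 (hY.trans hs)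
  -- 1.0213 is a rounded-up square root of 1.043.
  have hnoise := ADMiRA.norm_map_le_of_rip 𝒜 hr (c := 1.0213) (by norm_num) (fun Y hY => by
    refine le_of_sq_le_sq ?_ (by positivity)
    have := (hrip r (by omega) Y hY).2
    nlinarith [sq_nonneg ‖Y‖]) (X - Xr)
  have htail : 0 ≤ 1 / Real.sqrt r * ADMiRA.nuclearNorm (X - Xr) :=
    mul_nonneg (by positivity) (ADMiRA.nuclearNorm_nonneg _)
  have hb' : b = 𝒜 Xr + (𝒜 (X - Xr) + ν) := by rw [hb, map_sub]; abel
  have hw := norm_add_le (𝒜 (X - Xr)) ν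
  have hstep : ∀ k : ℕ, (k : ℕ∞) < N →
      ‖X - Xh (k + 1)‖ ≤ 0.5 * ‖X - Xh k‖ + 10 * ADMiRA.unrecoverableEnergy r X Xr ν := by
    intro k hk
    have h := hrun.step k hk
    rw [hb'] at h
    have h1 := h.norm_sub_le h𝕆 (hrip _ (by omega)) hXr.1 (hrun.isEstimate k hk.le)
    have h2 := norm_sub_le_norm_sub_add_norm_sub X Xr (Xh (k + 1))
    have h3 := norm_sub_le_norm_sub_add_norm_sub Xr X (Xh k)
    rw [norm_sub_rev Xr X] at h3
    unfold ADMiRA.unrecoverableEnergy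
    -- The coefficient of ‖X - Xr‖ is 1 + 0.18 + 6.41 · 1.0213 < 10.
    linarith [norm_nonneg (X - Xh k), norm_nonneg (X - Xr), norm_nonneg ν]
  refine ⟨hstep, fun k => ?_⟩
  induction k with
  | zero =>
    intro _
    rw [hrun.init_estimate, sub_zero, pow_zero, one_mul, ADMiRA.unrecoverableEnergy]
    linarith [norm_nonneg (X - Xr), norm_nonneg ν]
  | succ k ih =>
    intro hk
    have hlt : (k : ℕ∞) < N := lt_of_lt_of_le (by exact_mod_cast k.lt_succ_self) hk
    have h1 := hstep k hlt
    have h2 := ih hlt.le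
    rw [pow_succ]
    -- The constant 20 is the fixed point of t ↦ 0.5 t + 10.
    linarith
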